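/- Let $G\ge 2$, let $p_1,\dots,p_G>0$ with $\sum_g p_g=1$, and let $s=(s_1,\dots,s_G)\in[0,1]^G$. Let $(A_i,Y_i)_{i\ge 1}$ be i.i.d. with $A_i\in\{1,\dots,G\}$, $Y_i\in\{0,1\}$, $P(A_i=g)=p_g$ and $P(Y_i=1\mid A_i=g)=s_g$, and let $$\hat s_g=\hat s_g^{(N)}=\frac{\#\{i\le N: A_i=g,\,Y_i=1\}}{\#\{i\le N: A_i=g\}}$$ be the group sample means (with the value $0$ if the group is empty). For a fixed $\alpha>0$ and $a\in\mathbb R^G$ put $$\mathrm{rsmax}_\alpha(a)=\frac1\alpha\log\sum_{j=1}^G e^{\alpha a_j},\qquad \mathrm{rsmin}_\alpha(a)=-\mathrm{rsmax}_\alpha(-a),\qquad h(a)=\begin{bmatrix}\mathrm{rsmin}_\alpha(a)\\ \mathrm{rsmax}_\alpha(a)\end{bmatrix},$$ $$\mathrm{softmax}_\alpha(a)=\Big(\frac{e^{\alpha a_j}}{\sum_i e^{\alpha a_i}}\Big)_{j},\qquad \mathrm{softmin}_\alpha(a)=\mathrm{softmax}_\alpha(-a),$$ and $g(x,y)=x/y$.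 Let $\widehat{\mathrm{DP}}=g(h(\hat s))=\mathrm{rsmin}_\alpha(\hat s)/\mathrm{rsmax}_\alpha(\hat s)$ and $\mathrm{DP}_0=g(h(s))=\mathrm{rsmin}_\alpha(s)/\mathrm{rsmax}_\alpha(s)$. Then, for every such $s$, whether or not some of the $s_g$ are equal: 1. $\mathrm{rsmax}_\alpha(s)>0$, and $\mathrm{rsmax}_\alpha(\hat s)>0$ for every $N$ and every outcome. 2. $\mathrm{rsmin}_\alpha$ and $\mathrm{rsmax}_\alpha$ are differentiable at every point of $\mathbb R^G$, with gradients $\mathrm{softmin}_\alpha$ and $\mathrm{softmax}_\alpha$, and $g$ is differentiable at $h(s)$ with gradient $\nabla g=[1/b,\,-a/b^2]^\top$, where $a=\mathrm{rsmin}_\alpha(s)$ and $b=\mathrm{rsmax}_\alpha(s)$. 3. As $N\to\infty$, in distribution, $$\sqrt N(\hat s-s)\to\mathcal N(0,\Sigma),\qquad \Sigma=\mathrm{diag}\Big(\frac{s_g(1-s_g)}{p_g}\Big)_{g},$$ $$\sqrt N\big(h(\hat s)-h(s)\big)\to\mathcal N(0,\Sigma'),\qquad \Sigma'=\nabla^\top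 h\,\Sigma\,\nabla h,$$ $$\sqrt N\big(\widehat{\mathrm{DP}}-\mathrm{DP}_0\big)\to\mathcal N\big(0,\ \nabla^\top g\,\Sigma'\,\nabla g\big),$$ where $\nabla h$ is the $G\times 2$ matrix with columns $\mathrm{softmin}_\alpha(s)$ and $\mathrm{softmax}_\alpha(s)$. The matrices $\Sigma,\Sigma'$ are positive semidefinite and $\nabla^\top g\,\Sigma'\,\nabla g\ge 0$; the normal laws may be degenerate (the point mass at $0$ if the variance is $0$). -/

import Mathlib

open MeasureTheory ProbabilityTheory Filter
open scoped Matrix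

noncomputable section

/-- The sampling model: the units `i = 0, 1, 2, …` are independent; unit `i` falls into group
`A i`, which is `g` with probability `p g`, and has the binary outcome `Y i`, which, given that
the group is `g`, is a success with probability `s g`. -/
structure IsGroupSample {Ω : Type*} [MeasurableSpace Ω] (μ : Measure Ω) {G : ℕ}
    (A : ℕ → Ω → Fin G) (Y : ℕ → Ω → Bool) (p : Fin G → ℝ)
    (s : EuclideanSpace ℝ (Fin G)) : Prop where
  measurable_group : ∀ i, Measurable (A i)
  measurable_outcome : ∀ i, Measurable (Y i)
  indep : iIndepFun (fun i ω => (A i ω, Y i ω)) μ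
  prob_group : ∀ i g, μ.real {ω | A i ω = g} = p g
  prob_success : ∀ i g, μ.real {ω | A i ω = g ∧ Y i ω = true} = p g * s g

/-- The vector of group sample means among the first `N` units: for each group, the number of
successes divided by the number of units (equal to `0` if the group has no unit). -/
def sampleMeans {Ω : Type*} {G : ℕ} (A : ℕ → Ω → Fin G) (Y : ℕ → Ω → Bool) (N : ℕ) (ω : Ω) :
    EuclideanSpace ℝ (Fin G) :=
  WithLp.toLp 2 fun g =>
    (((Finset.range N).filter fun i => A i ω = g ∧ Y i ω = true).card : ℝ) /
      (((Finset.range N).filter fun i => A i ω = g).card : ℝ)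

/-- The smooth maximum (LogSumExp). -/
def rsmax {G : ℕ} (α : ℝ) (a : EuclideanSpace ℝ (Fin G)) : ℝ :=
  1 / α * Real.log (∑ j, Real.exp (α * a j))

/-- The smooth minimum. -/
def rsmin {G : ℕ} (α : ℝ) (a : EuclideanSpace ℝ (Fin G)) : ℝ :=
  -rsmax α (-a)

def softmax {G : ℕ} (α : ℝ) (a : EuclideanSpace ℝ (Fin G)) : EuclideanSpace ℝ (Fin G) :=
  WithLp.toLp 2 fun j => Real.exp (α * a j) / ∑ i, Real.exp (α * a i)

def softmin {G : ℕ} (α : ℝ) (a : EuclideanSpace ℝ (Fin G)) : EuclideanSpace ℝ (Fin G) :=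
  softmax α (-a)

/-- The pair (smooth minimum, smooth maximum). -/
def softMinMax {G : ℕ} (α : ℝ) (a : EuclideanSpace ℝ (Fin G)) : EuclideanSpace ℝ (Fin 2) :=
  !₂[rsmin α a, rsmax α a]

/-- The Jacobian of `softMinMax α`, with the gradients of its two components as columns. -/
def jacMinMax {G : ℕ} (α : ℝ) (a : EuclideanSpace ℝ (Fin G)) : Matrix (Fin G) (Fin 2) ℝ :=
  Matrix.of fun j => ![softmin α a j, softmax α a j]

def ratio (x : EuclideanSpace ℝ (Fin 2)) : ℝ := x 0 / x 1

/-- The gradient of `ratio`. -/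
def gradRatio (x : EuclideanSpace ℝ (Fin 2)) : EuclideanSpace ℝ (Fin 2) :=
  !₂[1 / x 1, -x 0 / x 1 ^ 2]

/-- Soft demographic parity: smooth minimum over smooth maximum. -/
def softDP {G : ℕ} (α : ℝ) (a : EuclideanSpace ℝ (Fin G)) : ℝ := rsmin α a / rsmax α a

/-- The asymptotic covariance matrix of the group sample means. -/
def covMeans {G : ℕ} (p : Fin G → ℝ) (s : EuclideanSpace ℝ (Fin G)) :
    Matrix (Fin G) (Fin G) ℝ :=
  Matrix.diagonal fun g => s g * (1 - s g) / p g

/-- The asymptotic covariance matrix of the smooth minimum and maximum. -/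
def covMinMax {G : ℕ} (α : ℝ) (p : Fin G → ℝ) (s : EuclideanSpace ℝ (Fin G)) :
    Matrix (Fin 2) (Fin 2) ℝ :=
  (jacMinMax α s)ᵀ * covMeans p s * jacMinMax α s

/-- The asymptotic variance of the soft demographic parity estimator. -/
def varDP {G : ℕ} (α : ℝ) (p : Fin G → ℝ) (s : EuclideanSpace ℝ (Fin G)) : ℝ :=
  WithLp.ofLp (gradRatio (softMinMax α s)) ⬝ᵥ
    (covMinMax α p s *ᵥ WithLp.ofLp (gradRatio (softMinMax α s)))

/-- `√N (T N - θ)` converges in distribution to the centred multivariate normal law with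
covariance matrix `S` (which is a genuine covariance matrix, possibly singular). -/
def AsympNormalVec {Ω : Type*} [MeasurableSpace Ω] (μ : Measure Ω) [IsProbabilityMeasure μ]
    {d : ℕ} (T : ℕ → Ω → EuclideanSpace ℝ (Fin d)) (θ : EuclideanSpace ℝ (Fin d))
    (S : Matrix (Fin d) (Fin d) ℝ) : Prop :=
  S.PosSemidef ∧
    TendstoInDistribution (fun (N : ℕ) ω => Real.sqrt N • (T N ω - θ)) atTop id
      (fun _ => μ) (multivariateGaussian 0 S)

/-- `√N (T N - θ)` converges in distribution to the centred normal law on `ℝ` with variance `v`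
(the point mass at `0` if `v = 0`). -/
def AsympNormal {Ω : Type*} [MeasurableSpace Ω] (μ : Measure Ω) [IsProbabilityMeasure μ]
    (T : ℕ → Ω → ℝ) (θ v : ℝ) : Prop :=
  0 ≤ v ∧
    TendstoInDistribution (fun (N : ℕ) ω => Real.sqrt N * (T N ω - θ)) atTop id
      (fun _ => μ) (gaussianReal 0 v.toNNReal)

end

/-!
The vector of group means is a ratio of two averages over the i.i.d. pairs (group, outcome), but
it needs no ratio expansion. Let `influence` be the random vector whose only nonzero coordinate,
that of the unit's own group `g`, is `(Y - s g) / p g`. It is centred with covariance matrix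
`diag (s g (1 - s g) / p g)`, so its normalised sums are asymptotically normal by the multivariate
central limit theorem (`tendstoInDistribution_multivariateGaussian`, which reduces to the
one-dimensional theorem by projecting and comparing characteristic functions). As soon as every
group is represented, `√N (ŝ - s)` is coordinatewise this normalised sum times `p g` over the
empirical frequency of group `g`. That factor tends to `1` by the strong law of large numbers, and
Slutsky's theorem gives `IsGroupSample.asympNormalVec_sampleMeans`.

The other two limits follow from the delta method (`tendstoInDistribution_delta_method`), used
once for `softMinMax α` at `s` and once for `ratio` at `softMinMax α s`. The derivatives there are
linear, and linear images of Gaussian laws are Gaussian with the transformed covariance, also when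
it is singular (`map_multivariateGaussian_eq_multivariateGaussian`,
`map_inner_multivariateGaussian`). The smooth maximum and minimum are differentiable everywhere,
so ties among the `s g` play no role, and `rsmax α s > 0` because a sum of at least two
exponentials of nonnegative numbers exceeds `1`.
-/

open scoped Topology RealInnerProductSpace

/-! ### Convergence in distribution -/

/-- Convergence in distribution depends on the limit variable only through its law. -/
lemma tendstoInDistribution_id_of_map_eq {ι Ω Ω' E : Type*} [MeasurableSpace Ω]
    [MeasurableSpace Ω'] [TopologicalSpace E] [MeasurableSpace E] [OpensMeasurableSpace E]
    {μ : Measure Ω} [IsProbabilityMeasure μ] {μ' : Measure Ω'} [IsProbabilityMeasure μ']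
    {ν : Measure E} [IsProbabilityMeasure ν] {l : Filter ι} {X : ι → Ω → E} {Z : Ω' → E}
    (h : TendstoInDistribution X l Z (fun _ => μ) μ') (hZ : μ'.map Z = ν) :
    TendstoInDistribution X l id (fun _ => μ) ν where
  forall_aemeasurable := h.forall_aemeasurable
  aemeasurable_limit := aemeasurable_id
  tendsto := by
    have h1 := h.tendsto
    have h2 : (⟨μ'.map Z, Measure.isProbabilityMeasure_map h.aemeasurable_limit⟩ :
        ProbabilityMeasure E) = ⟨ν.map id, Measure.isProbabilityMeasure_map aemeasurable_id⟩ :=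
      Subtype.ext (by simp [hZ])
    rwa [h2] at h1

/-- The **delta method**: the first-order Taylor remainder is `‖T n - θ‖ • ρ (T n)` with
`ρ (T n) → 0`, so Slutsky's theorem makes it negligible after rescaling. -/
theorem tendstoInDistribution_delta_method {Ω Ω' E F : Type*} [MeasurableSpace Ω]
    [MeasurableSpace Ω'] [NormedAddCommGroup E] [NormedSpace ℝ E] [SecondCountableTopology E]
    [MeasurableSpace E] [BorelSpace E] [NormedAddCommGroup F] [NormedSpace ℝ F]
    [SecondCountableTopology F] [MeasurableSpace F] [BorelSpace F]
    {μ : Measure Ω} [IsProbabilityMeasure μ] {μ' : Measure Ω'} [IsProbabilityMeasure μ']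
    {T : ℕ → Ω → E} {θ : E} {r : ℕ → ℝ} {Z : Ω' → E} {f : E → F} {L : E →L[ℝ] F}
    (hT : TendstoInDistribution (fun n ω => r n • (T n ω - θ)) atTop Z (fun _ => μ) μ')
    (hTm : ∀ n, AEMeasurable (T n) μ) (hTθ : ∀ᵐ ω ∂μ, Tendsto (fun n => T n ω) atTop (𝓝 θ))
    (hr : ∀ n, 0 ≤ r n) (hf : HasFDerivAt f L θ) (hfm : Measurable f) :
    TendstoInDistribution (fun n ω => r n • (f (T n ω) - f θ)) atTop (L ∘ Z) (fun _ => μ) μ' := by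
  set ρ : E → F := fun x => ‖x - θ‖⁻¹ • (f x - f θ - L (x - θ)) with hρ
  have hρm : Measurable ρ := by fun_prop
  have hρ0 : Tendsto ρ (𝓝 θ) (𝓝 0) := by
    rw [tendsto_zero_iff_norm_tendsto_zero]
    simpa [hρ, norm_smul] using hasFDerivAt_iff_tendsto.1 hf
  have hm : TendstoInMeasure μ (fun n ω => ρ (T n ω)) atTop (fun _ => (0 : F)) := by
    refine tendstoInMeasure_of_tendsto_ae
      (fun n => (hρm.comp_aemeasurable (hTm n)).aestronglyMeasurable) ?_
    filter_upwards [hTθ] with ω hω using hρ0.comp hω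
  have key := hT.continuous_comp_prodMk_of_tendstoInMeasure_const
    (g := fun q : E × F => L q.1 + ‖q.1‖ • q.2) (by fun_prop) hm
    (fun n => hρm.comp_aemeasurable (hTm n))
  convert key using 1
  · funext n ω
    rcases eq_or_ne (T n ω) θ with h | h
    · simp [h]
    · have h' : ‖T n ω - θ‖ ≠ 0 := by simpa [sub_eq_zero] using h
      simp only [hρ, norm_smul, Real.norm_of_nonneg (hr n), map_smul, mul_smul]
      rw [smul_inv_smul₀ h', ← smul_add]
      simp
  · funext ω
    simp

/-- The **multivariate central limit theorem** for centred variables, by the Cramér–Wold device: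
the characteristic functions are those of the one-dimensional projections. -/
theorem tendstoInDistribution_multivariateGaussian {Ω ι : Type*} [MeasurableSpace Ω] [Fintype ι]
    [DecidableEq ι] {μ : Measure Ω} [IsProbabilityMeasure μ] {X : ℕ → Ω → EuclideanSpace ℝ ι}
    {S : Matrix ι ι ℝ} (hS : S.PosSemidef) (hX : MemLp (X 0) 2 μ) (hindep : iIndepFun X μ)
    (hident : ∀ i, IdentDistrib (X i) (X 0) μ μ) (hmean : ∀ t, ∫ ω, ⟪X 0 ω, t⟫ ∂μ = 0)
    (hvar : ∀ t, ∫ ω, ⟪X 0 ω, t⟫ ^ 2 ∂μ = t ⬝ᵥ S *ᵥ t) :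
    TendstoInDistribution (fun (n : ℕ) ω => (√n)⁻¹ • ∑ i ∈ Finset.range n, X i ω) atTop id
      (fun _ => μ) (multivariateGaussian 0 S) where
  forall_aemeasurable n := by
    have := fun i => (hident i).aemeasurable_fst
    fun_prop
  aemeasurable_limit := aemeasurable_id
  tendsto := by
    refine ProbabilityMeasure.tendsto_iff_tendsto_charFun.2 fun t => ?_
    have hm := fun i => (hident i).aemeasurable_fst
    have hu : Measurable fun x : EuclideanSpace ℝ ι => ⟪x, t⟫ := by fun_prop
    have hv : Var[fun ω => ⟪X 0 ω, t⟫; μ] = t ⬝ᵥ S *ᵥ t := by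
      rw [variance_of_integral_eq_zero (by fun_prop) (hmean t), hvar]
    have hv0 : 0 ≤ t ⬝ᵥ S *ᵥ t := hv ▸ variance_nonneg _ _
    have clt := tendstoInDistribution_inv_sqrt_mul_sum_sub (P := μ)
      (X := fun i ω => ⟪X i ω, t⟫) (Y := id)
      (P' := gaussianReal 0 Var[fun ω => ⟪X 0 ω, t⟫; μ].toNNReal) ⟨aemeasurable_id, by simp⟩
      (hX.inner_const t) (hindep.comp (fun _ x => ⟪x, t⟫) fun _ => hu)
      (fun i => (hident i).comp hu)
    -- The characteristic function at `t` is that of the projection along `t` at `1`.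
    have h1 := ProbabilityMeasure.tendsto_iff_tendsto_charFun.1 clt.tendsto 1
    simp only [ProbabilityMeasure.coe_mk, Measure.map_id] at h1 ⊢
    rw [charFun_multivariateGaussian hS]
    rw [charFun_gaussianReal, hv] at h1
    convert h1 using 2
    · rename_i n
      rw [charFun_apply, charFun_apply, integral_map (by fun_prop) (by fun_prop),
        integral_map (by fun_prop) (by fun_prop)]
      simp [hmean, inner_smul_left, sum_inner]
    · simp [Real.coe_toNNReal _ hv0]

/-! ### Images of Gaussian measures -/

lemma map_multivariateGaussian_eq_multivariateGaussian {ι κ : Type*} [Fintype ι] [DecidableEq ι]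
    [Fintype κ] [DecidableEq κ] {S : Matrix ι ι ℝ} (hS : S.PosSemidef) (J : Matrix ι κ ℝ)
    {L : EuclideanSpace ℝ ι →L[ℝ] EuclideanSpace ℝ κ}
    (hL : ∀ x, WithLp.ofLp (L x) = Jᵀ *ᵥ WithLp.ofLp x) :
    (multivariateGaussian 0 S).map L = multivariateGaussian 0 (Jᵀ * S * J) := by
  have hS' : (Jᵀ * S * J).PosSemidef := by
    simpa using hS.conjTranspose_mul_mul_same J
  refine Measure.ext_of_charFun (funext fun t => ?_)
  have h : ∀ x, ⟪L x, t⟫ = ⟪x, WithLp.toLp 2 (J *ᵥ WithLp.ofLp t)⟫ := fun x => by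
    simp only [EuclideanSpace.inner_eq_star_dotProduct, hL, star_trivial]
    rw [Matrix.mulVec_transpose, dotProduct_comm, ← Matrix.dotProduct_mulVec, dotProduct_comm]
  rw [charFun_apply, integral_map (by fun_prop) (by fun_prop)]
  simp_rw [h]
  rw [← charFun_apply, charFun_multivariateGaussian hS, charFun_multivariateGaussian hS']
  simp only [inner_zero_right, ← Matrix.mulVec_mulVec, Matrix.dotProduct_mulVec,
    Matrix.vecMul_transpose]

lemma map_inner_multivariateGaussian {ι : Type*} [Fintype ι] [DecidableEq ι] {S : Matrix ι ι ℝ}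
    (hS : S.PosSemidef) (v : EuclideanSpace ℝ ι) :
    (multivariateGaussian 0 S).map (fun x => ⟪v, x⟫) =
      gaussianReal 0 (v ⬝ᵥ S *ᵥ v).toNNReal := by
  have h0 : 0 ≤ v ⬝ᵥ S *ᵥ v := by simpa using hS.dotProduct_mulVec_nonneg v
  refine Measure.ext_of_charFun (funext fun t => ?_)
  rw [charFun_apply, integral_map (by fun_prop) (by fun_prop)]
  have h : ∀ x, ⟪⟪v, x⟫, t⟫ = ⟪x, t • v⟫ := fun x => by
    simp [inner_smul_right, real_inner_comm]
  simp_rw [h]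
  rw [← charFun_apply, charFun_multivariateGaussian hS, charFun_gaussianReal]
  simp [Matrix.mulVec_smul, Real.coe_toNNReal _ h0]
  ring_nf

/-! ### The sampling model -/

/-- The indicator that a unit, given as the pair (group, outcome), lies in group `g`. -/
def inGroup {G : ℕ} (g : Fin G) (x : Fin G × Bool) : ℝ := if x.1 = g then 1 else 0

/-- The indicator that a unit, given as the pair (group, outcome), is a success in group `g`. -/
def successIn {G : ℕ} (g : Fin G) (x : Fin G × Bool) : ℝ :=
  if x.1 = g ∧ x.2 = true then 1 else 0

lemma sampleMeans_apply {Ω : Type*} {G : ℕ} (A : ℕ → Ω → Fin G) (Y : ℕ → Ω → Bool) (N : ℕ) (ω : Ω)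
    (g : Fin G) :
    sampleMeans A Y N ω g = (∑ i ∈ Finset.range N, successIn g (A i ω, Y i ω)) /
      ∑ i ∈ Finset.range N, inGroup g (A i ω, Y i ω) := by
  simp [sampleMeans, successIn, inGroup, Finset.sum_boole]

lemma posSemidef_covMeans {G : ℕ} {p : Fin G → ℝ} {s : EuclideanSpace ℝ (Fin G)}
    (hp : ∀ g, 0 < p g) (hs : ∀ g, 0 ≤ s g ∧ s g ≤ 1) :
    (covMeans p s).PosSemidef :=
  Matrix.PosSemidef.diagonal fun g =>
    div_nonneg (mul_nonneg (hs g).1 (sub_nonneg.2 (hs g).2)) (hp g).le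

section Sampling

variable {Ω : Type*} [MeasurableSpace Ω] {μ : Measure Ω} {G : ℕ} {A : ℕ → Ω → Fin G}
  {Y : ℕ → Ω → Bool} {p : Fin G → ℝ} {s : EuclideanSpace ℝ (Fin G)}

/-- The influence function of the vector of group means at a unit: in the coordinate of the
unit's group, the centred outcome divided by the group probability, and `0` elsewhere. -/
noncomputable def influence (p : Fin G → ℝ) (s : EuclideanSpace ℝ (Fin G)) (x : Fin G × Bool) :
    EuclideanSpace ℝ (Fin G) :=
  WithLp.toLp 2 fun g => (successIn g x - s g * inGroup g x) / p g

lemma inner_influence (x : Fin G × Bool) (t : EuclideanSpace ℝ (Fin G)) :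
    ⟪influence p s x, t⟫ = t x.1 * (((if x.2 = true then 1 else 0) - s x.1) / p x.1) := by
  simp only [PiLp.inner_apply, influence]
  rw [Finset.sum_eq_single x.1]
  · simp [successIn, inGroup]
  · intro g _ hg
    simp [successIn, inGroup, hg.symm]
  · simp

namespace IsGroupSample

variable (h : IsGroupSample μ A Y p s)
include h

lemma measurable_unit (i : ℕ) : Measurable fun ω => (A i ω, Y i ω) :=
  (h.measurable_group i).prodMk (h.measurable_outcome i)

lemma measurable_sampleMeans (N : ℕ) : Measurable (sampleMeans A Y N) := by
  have hm (f : Fin G × Bool → ℝ) :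
      Measurable fun ω => ∑ i ∈ Finset.range N, f (A i ω, Y i ω) :=
    Finset.measurable_sum _ fun i _ =>
      (measurable_of_countable f).comp (h.measurable_unit i)
  refine (WithLp.measurable_toLp 2 _).comp (measurable_pi_lambda _ fun g => ?_)
  have := (hm (successIn g)).div (hm (inGroup g))
  convert this using 1
  funext ω
  exact sampleMeans_apply A Y N ω g

lemma map_real_singleton_true (i : ℕ) (g : Fin G) :
    (μ.map fun ω => (A i ω, Y i ω)).real {(g, true)} = p g * s g := by
  rw [map_measureReal_apply (h.measurable_unit i) (measurableSet_singleton _), ← h.prob_success i g]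
  congr 1
  ext ω
  simp

variable [IsProbabilityMeasure μ]

lemma map_real_singleton_false (i : ℕ) (g : Fin G) :
    (μ.map fun ω => (A i ω, Y i ω)).real {(g, false)} = p g * (1 - s g) := by
  have hY : MeasurableSet {ω | Y i ω = true} :=
    h.measurable_outcome i (measurableSet_singleton true)
  have hd := measureReal_inter_add_sdiff (μ := μ) (s := {ω | A i ω = g}) hY
  have h1 : {ω | A i ω = g} ∩ {ω | Y i ω = true} = {ω | A i ω = g ∧ Y i ω = true} := rfl
  rw [h1, h.prob_success, h.prob_group] at hd
  rw [map_measureReal_apply (h.measurable_unit i) (measurableSet_singleton _)]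
  have h2 : (fun ω => (A i ω, Y i ω)) ⁻¹' {(g, false)} =
      {ω | A i ω = g} \ {ω | Y i ω = true} := by
    ext ω
    simp
  rw [h2]
  linarith

lemma identDistrib (i : ℕ) :
    IdentDistrib (fun ω => (A i ω, Y i ω)) (fun ω => (A 0 ω, Y 0 ω)) μ μ where
  aemeasurable_fst := (h.measurable_unit i).aemeasurable
  aemeasurable_snd := (h.measurable_unit 0).aemeasurable
  map_eq := by
    have := fun i => Measure.isProbabilityMeasure_map (μ := μ) (h.measurable_unit i).aemeasurable
    refine MeasureTheory.ext_iff_measureReal_singleton.2 fun ⟨g, b⟩ => ?_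
    cases b
    · rw [h.map_real_singleton_false, h.map_real_singleton_false]
    · rw [h.map_real_singleton_true, h.map_real_singleton_true]

/-- Expectations of functions of one unit, as sums over the values of (group, outcome). -/
lemma integral_comp (f : Fin G × Bool → ℝ) (i : ℕ) :
    ∫ ω, f (A i ω, Y i ω) ∂μ =
      ∑ g, (p g * s g * f (g, true) + p g * (1 - s g) * f (g, false)) := by
  have := Measure.isProbabilityMeasure_map (μ := μ) (h.measurable_unit i).aemeasurable
  rw [← integral_map (φ := fun ω => (A i ω, Y i ω)) (h.measurable_unit i).aemeasurable
    (measurable_of_countable f).aestronglyMeasurable, integral_fintype .of_finite,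
    Fintype.sum_prod_type]
  simp [h.map_real_singleton_true, h.map_real_singleton_false]

lemma tendsto_average (f : Fin G × Bool → ℝ) :
    ∀ᵐ ω ∂μ, Tendsto (fun n : ℕ => (∑ i ∈ Finset.range n, f (A i ω, Y i ω)) / n) atTop
      (𝓝 (∑ g, (p g * s g * f (g, true) + p g * (1 - s g) * f (g, false)))) := by
  have hf : Measurable f := measurable_of_countable f
  have hfm := hf.comp (h.measurable_unit 0)
  obtain ⟨C, hC⟩ := (Set.finite_range fun x => ‖f x‖).bddAbove
  rw [← h.integral_comp f 0]
  exact strong_law_ae_real (fun i ω => f (A i ω, Y i ω))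
    (.of_bound hfm.aestronglyMeasurable C (.of_forall fun ω => hC ⟨_, rfl⟩))
    (fun i j hij => (h.indep.indepFun hij).comp hf hf) fun i => (h.identDistrib i).comp hf

lemma tendsto_average_inGroup :
    ∀ᵐ ω ∂μ, ∀ g, Tendsto (fun n : ℕ => (∑ i ∈ Finset.range n, inGroup g (A i ω, Y i ω)) / n)
      atTop (𝓝 (p g)) := by
  refine ae_all_iff.2 fun g => ?_
  filter_upwards [h.tendsto_average (inGroup g)] with ω hω
  convert hω using 2
  simp only [inGroup, mul_ite, mul_one, mul_zero]
  rw [Finset.sum_eq_single g (by simp +contextual) (by simp)]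
  simp
  ring

lemma tendsto_average_successIn :
    ∀ᵐ ω ∂μ, ∀ g, Tendsto
      (fun n : ℕ => (∑ i ∈ Finset.range n, successIn g (A i ω, Y i ω)) / n)
      atTop (𝓝 (p g * s g)) := by
  refine ae_all_iff.2 fun g => ?_
  filter_upwards [h.tendsto_average (successIn g)] with ω hω
  convert hω using 2
  simp [successIn]

/-- The group sample means are strongly consistent. -/
lemma tendsto_sampleMeans (hp : ∀ g, 0 < p g) :
    ∀ᵐ ω ∂μ, Tendsto (fun N => sampleMeans A Y N ω) atTop (𝓝 s) := by
  filter_upwards [h.tendsto_average_inGroup, h.tendsto_average_successIn] with ω h1 h2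
  refine ((PiLp.continuous_toLp 2 _).tendsto (WithLp.ofLp s)).comp
    (tendsto_pi_nhds.2 fun g => ?_)
  have h3 := (h2 g).div (h1 g) (hp g).ne'
  rw [mul_div_cancel_left₀ _ (hp g).ne'] at h3
  refine h3.congr' ?_
  filter_upwards [eventually_ne_atTop 0] with N hN
  refine Eq.trans ?_ (sampleMeans_apply A Y N ω g).symm
  exact div_div_div_cancel_right₀ (by exact_mod_cast hN) _ _

/-- The central limit theorem for the influence function, whose covariance matrix is diagonal
because a unit belongs to one group only. -/
lemma tendstoInDistribution_influence (hp : ∀ g, 0 < p g) (hs : ∀ g, 0 ≤ s g ∧ s g ≤ 1) :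
    TendstoInDistribution
      (fun (n : ℕ) ω => (√n)⁻¹ • ∑ i ∈ Finset.range n, influence p s (A i ω, Y i ω)) atTop id
      (fun _ => μ) (multivariateGaussian 0 (covMeans p s)) := by
  have hI : Measurable (influence p s) := measurable_of_countable _
  obtain ⟨C, hC⟩ := (Set.finite_range fun x => ‖influence p s x‖).bddAbove
  refine tendstoInDistribution_multivariateGaussian (X := fun i ω => influence p s (A i ω, Y i ω))
    (posSemidef_covMeans hp hs)
    (.of_bound (hI.comp (h.measurable_unit 0)).aestronglyMeasurable C
      (.of_forall fun ω => hC ⟨_, rfl⟩))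
    (h.indep.comp (fun _ => influence p s) fun _ => hI) (fun i => (h.identDistrib i).comp hI)
    (fun t => ?_) fun t => ?_
  · rw [h.integral_comp (fun x => ⟪influence p s x, t⟫) 0]
    refine Finset.sum_eq_zero fun g _ => ?_
    simp [inner_influence]
    ring
  · rw [h.integral_comp (fun x => ⟪influence p s x, t⟫ ^ 2) 0, covMeans, dotProduct]
    refine Finset.sum_congr rfl fun g _ => ?_
    have := (hp g).ne'
    simp only [inner_influence, Matrix.mulVec_diagonal, if_true, Bool.false_eq_true, if_false]
    field_simp
    ring

/-- Asymptotic normality of the group sample means. Almost surely and for all large `N`,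
`√N (ŝ_g - s_g)` is the normalised sum of the influence function times the ratio of `p_g` to the
empirical frequency of the group, and this ratio tends to `1`. -/
theorem asympNormalVec_sampleMeans (hp : ∀ g, 0 < p g) (hs : ∀ g, 0 ≤ s g ∧ s g ≤ 1) :
    AsympNormalVec μ (sampleMeans A Y) s (covMeans p s) := by
  refine ⟨posSemidef_covMeans hp hs, ?_⟩
  set c : ℕ → Ω → EuclideanSpace ℝ (Fin G) := fun N ω => WithLp.toLp 2 fun g =>
    p g / ((∑ i ∈ Finset.range N, inGroup g (A i ω, Y i ω)) / N) with hc
  have hcm (N : ℕ) : Measurable (c N) := by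
    refine (WithLp.measurable_toLp 2 _).comp (measurable_pi_lambda _ fun g => ?_)
    exact measurable_const.div ((Finset.measurable_sum _ fun i _ =>
      (measurable_of_countable (inGroup g)).comp (h.measurable_unit i)).div_const _)
  have hc1 : ∀ᵐ ω ∂μ, Tendsto (fun N => c N ω) atTop (𝓝 (WithLp.toLp 2 fun _ => (1 : ℝ))) := by
    filter_upwards [h.tendsto_average_inGroup] with ω hω
    refine ((PiLp.continuous_toLp 2 _).tendsto _).comp (tendsto_pi_nhds.2 fun g => ?_)
    have := (tendsto_const_nhds (x := p g)).div (hω g) (hp g).ne'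
    rwa [div_self (hp g).ne'] at this
  have hslutsky : TendstoInDistribution (fun (N : ℕ) ω => (WithLp.toLp 2 fun g => c N ω g *
      ((√N)⁻¹ • ∑ i ∈ Finset.range N, influence p s (A i ω, Y i ω)) g :
        EuclideanSpace ℝ (Fin G))) atTop id (fun _ => μ) (multivariateGaussian 0 (covMeans p s)) :=
    (h.tendstoInDistribution_influence hp hs).continuous_comp_prodMk_of_tendstoInMeasure_const
      (g := fun q : EuclideanSpace ℝ (Fin G) × EuclideanSpace ℝ (Fin G) =>
        (WithLp.toLp 2 fun g => q.2 g * q.1 g : EuclideanSpace ℝ (Fin G)))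
      (by fun_prop)
      (tendstoInMeasure_of_tendsto_ae (fun N => (hcm N).aestronglyMeasurable) hc1)
      (fun N => (hcm N).aemeasurable)
      |>.congr (fun _ => .rfl) (.of_forall fun ω => by simp)
  have hm (N : ℕ) : Measurable fun ω => √N • (sampleMeans A Y N ω - s) :=
    ((h.measurable_sampleMeans N).sub_const s).const_smul (√N)
  refine tendstoInDistribution_of_tendstoInMeasure_sub _ _ hslutsky ?_ fun N => (hm N).aemeasurable
  refine tendstoInMeasure_of_tendsto_ae (fun N => ?_) ?_
  · exact ((hm N).aemeasurable.sub (hslutsky.forall_aemeasurable N)).aestronglyMeasurable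
  -- A positive limiting frequency makes every group nonempty for large `N`; from then on the
  -- value of a sample mean at an empty group is irrelevant and the difference vanishes exactly.
  · filter_upwards [h.tendsto_average_inGroup] with ω hω
    refine tendsto_const_nhds.congr' ?_
    filter_upwards [eventually_all.2 fun g => (hω g).eventually_ne (hp g).ne'] with N hN
    ext g
    have hn := hN g
    have hn0 : ∑ i ∈ Finset.range N, inGroup g (A i ω, Y i ω) ≠ 0 := fun h0 => hn (by simp [h0])
    have hN0 : (N : ℝ) ≠ 0 := fun h0 => hn (by simp [h0])
    have hNs : √(N : ℝ) ≠ 0 := by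
      rw [Real.sqrt_ne_zero']
      exact lt_of_le_of_ne N.cast_nonneg hN0.symm
    have hpg := (hp g).ne'
    simp only [hc, influence, Pi.sub_apply, PiLp.sub_apply, PiLp.smul_apply,
      sampleMeans_apply A Y N ω g, WithLp.ofLp_sum, Finset.sum_apply, smul_eq_mul,
      ← Finset.sum_div, Finset.sum_sub_distrib,
      ← Finset.mul_sum, Pi.zero_apply, PiLp.zero_apply]
    symm
    rw [sub_eq_zero]
    field_simp
    rw [Real.sq_sqrt N.cast_nonneg]
    ring

end IsGroupSample

end Sampling

/-! ### Smooth minimum and maximum -/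

lemma rsmax_pos {G : ℕ} (hG : 2 ≤ G) {α : ℝ} (hα : 0 < α) {a : EuclideanSpace ℝ (Fin G)}
    (ha : ∀ g, 0 ≤ a g) : 0 < rsmax α a := by
  refine mul_pos (one_div_pos.2 hα) (Real.log_pos ?_)
  calc (1 : ℝ) < G := by exact_mod_cast hG
    _ = ∑ _j : Fin G, (1 : ℝ) := by simp
    _ ≤ _ := Finset.sum_le_sum fun j _ => Real.one_le_exp (mul_nonneg hα.le (ha j))

lemma sampleMeans_nonneg {Ω : Type*} {G : ℕ} (A : ℕ → Ω → Fin G) (Y : ℕ → Ω → Bool) (N : ℕ)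
    (ω : Ω) (g : Fin G) : 0 ≤ sampleMeans A Y N ω g :=
  div_nonneg (Nat.cast_nonneg _) (Nat.cast_nonneg _)

lemma hasGradientAt_rsmax {G : ℕ} [NeZero G] {α : ℝ} (hα : α ≠ 0)
    (a : EuclideanSpace ℝ (Fin G)) : HasGradientAt (rsmax α) (softmax α a) a := by
  rw [hasGradientAt_iff_hasFDerivAt]
  have hpos : 0 < ∑ j, Real.exp (α * a j) :=
    Finset.sum_pos (fun _ _ => Real.exp_pos _) Finset.univ_nonempty
  have h1 (j : Fin G) : HasFDerivAt (fun x : EuclideanSpace ℝ (Fin G) => x j)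
      (EuclideanSpace.proj j : EuclideanSpace ℝ (Fin G) →L[ℝ] ℝ) a :=
    (EuclideanSpace.proj j : EuclideanSpace ℝ (Fin G) →L[ℝ] ℝ).hasFDerivAt
  have h2 := ((HasFDerivAt.fun_sum (u := Finset.univ)
    fun j _ => ((h1 j).const_mul α).exp).log hpos.ne').const_mul (1 / α)
  refine h2.congr_fderiv ?_
  ext x
  simp only [softmax, InnerProductSpace.toDual_apply_apply, PiLp.inner_apply]
  simp [Finset.mul_sum]
  refine Finset.sum_congr rfl fun j _ => ?_
  field_simp

lemma hasGradientAt_rsmin {G : ℕ} [NeZero G] {α : ℝ} (hα : α ≠ 0)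
    (a : EuclideanSpace ℝ (Fin G)) : HasGradientAt (rsmin α) (softmin α a) a := by
  rw [hasGradientAt_iff_hasFDerivAt]
  have h := ((hasGradientAt_rsmax hα (-a)).hasFDerivAt.comp a (hasFDerivAt_id a).neg).neg
  refine h.congr_fderiv ?_
  ext x
  simp [softmin]

lemma hasGradientAt_ratio {x : EuclideanSpace ℝ (Fin 2)} (hx : x 1 ≠ 0) :
    HasGradientAt ratio (gradRatio x) x := by
  rw [hasGradientAt_iff_hasFDerivAt]
  have h1 (j : Fin 2) : HasFDerivAt (fun x : EuclideanSpace ℝ (Fin 2) => x j)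
      (EuclideanSpace.proj j : EuclideanSpace ℝ (Fin 2) →L[ℝ] ℝ) x :=
    (EuclideanSpace.proj j : EuclideanSpace ℝ (Fin 2) →L[ℝ] ℝ).hasFDerivAt
  have h2 : ratio = fun x => x 0 * (x 1)⁻¹ := funext fun x => div_eq_mul_inv _ _
  rw [h2]
  refine ((h1 0).mul ((hasDerivAt_inv hx).comp_hasFDerivAt x (h1 1))).congr_fderiv ?_
  ext y
  simp [gradRatio, PiLp.inner_apply]
  field_simp
  ring

/-- The derivative of `softMinMax α` acts by the transpose of `jacMinMax α`, whose columns are the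
gradients. -/
lemma hasFDerivAt_softMinMax {G : ℕ} [NeZero G] {α : ℝ} (hα : α ≠ 0)
    (a : EuclideanSpace ℝ (Fin G)) :
    ∃ L : EuclideanSpace ℝ (Fin G) →L[ℝ] EuclideanSpace ℝ (Fin 2),
      HasFDerivAt (softMinMax α) L a ∧
        ∀ x, WithLp.ofLp (L x) = (jacMinMax α a)ᵀ *ᵥ WithLp.ofLp x := by
  refine ⟨(Matrix.toLpLin 2 2 (jacMinMax α a)ᵀ).toContinuousLinearMap, ?_, fun x => by simp⟩
  rw [← hasFDerivWithinAt_univ, hasFDerivWithinAt_euclidean]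
  simp only [hasFDerivWithinAt_univ]
  have h0 := (hasGradientAt_rsmin hα a).hasFDerivAt
  have h1 := (hasGradientAt_rsmax hα a).hasFDerivAt
  intro i
  fin_cases i
  · refine h0.congr_fderiv ?_
    ext x
    simp [PiLp.inner_apply, jacMinMax, Matrix.mulVec, dotProduct, mul_comm]
  · refine h1.congr_fderiv ?_
    ext x
    simp [PiLp.inner_apply, jacMinMax, Matrix.mulVec, dotProduct, mul_comm]

theorem mainTheorem1 {Ω : Type*} [MeasurableSpace Ω] (μ : Measure Ω) [IsProbabilityMeasure μ]
    (G : ℕ) (hG : 2 ≤ G)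
    (p : Fin G → ℝ) (hp : ∀ g, 0 < p g) (hp1 : ∑ g, p g = 1)
    (s : EuclideanSpace ℝ (Fin G)) (hs : ∀ g, 0 ≤ s g ∧ s g ≤ 1)
    (A : ℕ → Ω → Fin G) (Y : ℕ → Ω → Bool) (hAY : IsGroupSample μ A Y p s)
    (α : ℝ) (hα : 0 < α) :
    -- the denominators do not vanish
    0 < rsmax α s ∧ (∀ N ω, 0 < rsmax α (sampleMeans A Y N ω)) ∧
    -- the matrices and vectors in the variances are the gradients of the smoothed functions
    (∀ a : EuclideanSpace ℝ (Fin G), HasGradientAt (rsmin α) (softmin α a) a) ∧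
    (∀ a : EuclideanSpace ℝ (Fin G), HasGradientAt (rsmax α) (softmax α a) a) ∧
    HasGradientAt ratio (gradRatio (softMinMax α s)) (softMinMax α s) ∧
    -- asymptotic normality of the sample means, of the smoothed min and max, and of soft DP
    AsympNormalVec μ (sampleMeans A Y) s (covMeans p s) ∧
    AsympNormalVec μ (fun N ω => softMinMax α (sampleMeans A Y N ω)) (softMinMax α s)
      (covMinMax α p s) ∧
    AsympNormal μ (fun N ω => softDP α (sampleMeans A Y N ω)) (softDP α s) (varDP α p s) := by
  have : NeZero G := ⟨by omega⟩
  have hpos : 0 < rsmax α s := rsmax_pos hG hα fun g => (hs g).1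
  have hratio : HasGradientAt ratio (gradRatio (softMinMax α s)) (softMinMax α s) :=
    hasGradientAt_ratio (by simpa [softMinMax] using hpos.ne')
  have hmeans := hAY.asympNormalVec_sampleMeans hp hs
  obtain ⟨L, hL, hLJ⟩ := hasFDerivAt_softMinMax hα.ne' s
  have hcont : Continuous (softMinMax (G := G) α) := continuous_iff_continuousAt.2 fun a =>
    (hasFDerivAt_softMinMax hα.ne' a).choose_spec.1.continuousAt
  have hm N : Measurable (sampleMeans A Y N) := hAY.measurable_sampleMeans N
  have hmm : AsympNormalVec μ (fun N ω => softMinMax α (sampleMeans A Y N ω)) (softMinMax α s)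
      (covMinMax α p s) := by
    refine ⟨by simpa [covMinMax] using hmeans.1.conjTranspose_mul_mul_same (jacMinMax α s), ?_⟩
    exact tendstoInDistribution_id_of_map_eq
      (tendstoInDistribution_delta_method hmeans.2 (fun N => (hm N).aemeasurable)
        (hAY.tendsto_sampleMeans hp) (fun N => Real.sqrt_nonneg N) hL hcont.measurable)
      (map_multivariateGaussian_eq_multivariateGaussian hmeans.1 _ hLJ)
  refine ⟨hpos, fun N ω => rsmax_pos hG hα (sampleMeans_nonneg A Y N ω), hasGradientAt_rsmin hα.ne',
    hasGradientAt_rsmax hα.ne', hratio, hmeans, hmm, ?_, ?_⟩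
  · exact hmm.1.dotProduct_mulVec_nonneg (gradRatio (softMinMax α s)).ofLp
  · have hrm : Measurable ratio := by unfold ratio; fun_prop
    have hcons : ∀ᵐ ω ∂μ, Tendsto (fun N => softMinMax α (sampleMeans A Y N ω)) atTop
        (𝓝 (softMinMax α s)) := by
      filter_upwards [hAY.tendsto_sampleMeans hp] with ω hω using (hcont.tendsto s).comp hω
    have hd := tendstoInDistribution_delta_method hmm.2
      (fun N => (hcont.measurable.comp (hm N)).aemeasurable) hcons (fun N => Real.sqrt_nonneg N)
      hratio.hasFDerivAt hrm
    exact tendstoInDistribution_id_of_map_eq hd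
      (map_inner_multivariateGaussian hmm.1 (gradRatio (softMinMax α s)))
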